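/- Let $(\Omega,\mathcal F,(\mathcal F_t)_{t\ge 0},\mathbb P)$ be a filtered probability space carrying a one-dimensional standard $(\mathcal F_t)$-Brownian motion $W$ (adapted, with continuous paths, and with increments after time $s$ independent of $\mathcal F_s$). Let $\Delta_n>0$ be real numbers with $\Delta_n\to 0$ and $1/\Delta_n\in\mathbb N$, and write $t_i=i\Delta_n$. Let $a=(a_s)_{s\ge 0}$ be an $\mathbb R^d$-valued, $(\mathcal F_s)$-adapted, continuous and bounded process. Let $C([0,1])$ carry the supremum norm $\|\cdot\|_\infty$, and let $g:\mathbb R^d\times C([0,1])\to\mathbb R$ be a Borel measurable function of polynomial growth in the last variable, locally uniformly in the first: for every $R>0$ there are $K,p>0$ such that $|g(z,x)|\le K(1+\|x\|_\infty^p)$ for all $|z|\le R$ and $x\in C([0,1])$. Then $$\rho(z,g):=\mathbb E\big[g\big(z,\{W_s\}_{0\le s\le 1}\big)\big],\qquad z\in\mathbb R^d,$$ is well defined (the random variable is integrable). Assume that $z\mapsto\rho(z,g)$ is continuous on $\mathbb R^d$ (for instance, $g(\cdot,x)$ is continuous for every $x$). Then $s\mapsto\rho(a_s,g)$ is almost surely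 integrable on $[0,1]$, and $$\Delta_n\sum_{i=1}^{1/\Delta_n} g\Big(a_{t_{i-1}},\ \Delta_n^{-1/2}\{W_{t_{i-1}+s\Delta_n}-W_{t_{i-1}}\}_{0\le s\le 1}\Big)\ \longrightarrow\ \int_0^1\rho(a_s,g)\,ds\qquad\text{in probability as } n\to\infty .$$ -/

import Mathlib

open MeasureTheory ProbabilityTheory Filter Topology unitInterval
open scoped NNReal

/-- `W` is a standard one-dimensional Brownian motion with respect to the filtration `ℱ`:
a Brownian motion (with almost surely continuous paths) that is adapted to `ℱ` and whose
increments after time `s` are independent of `ℱ s`. -/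
structure IsFilteredBrownian {Ω : Type*} {mΩ : MeasurableSpace Ω}
    (W : ℝ≥0 → Ω → ℝ) (ℱ : Filtration ℝ≥0 mΩ) (P : Measure Ω) : Prop where
  isBrownian : IsBrownianReal W P
  adapted : Adapted ℱ W
  indep_increment : ∀ s t : ℝ≥0, s ≤ t →
    Indep (MeasurableSpace.comap (fun ω => W t ω - W s ω) inferInstance) (ℱ s) P

/-- The path `{W_s}_{0 ≤ s ≤ 1}` as a random element of `C([0,1])`. On the null event where it is
not continuous it is set to the zero path. -/
noncomputable def unitPath {Ω : Type*} (W : ℝ≥0 → Ω → ℝ) (ω : Ω) : C(I, ℝ) :=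
  ContinuousMap.mkD (fun s : I => W (unitInterval.toNNReal s) ω) 0

/-- The rescaled increment path `h^{-1/2} {W_{t + s h} - W_t}_{0 ≤ s ≤ 1}` as a random element of
`C([0,1])`. On the null event where it is not continuous it is set to the zero path. -/
noncomputable def scaledIncrementPath {Ω : Type*} (W : ℝ≥0 → Ω → ℝ) (t h : ℝ≥0) (ω : Ω) :
    C(I, ℝ) :=
  ContinuousMap.mkD
    (fun s : I => (Real.sqrt h)⁻¹ * (W (t + unitInterval.toNNReal s * h) ω - W t ω)) 0

/-- `g : ℝ^d × C([0,1]) → ℝ` has polynomial growth in the path variable, with constants that may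
be chosen uniformly for `z` in bounded sets. The norm on `C(I, ℝ)` is the supremum norm. -/
def PolynomialGrowthInPath {d : ℕ} (g : EuclideanSpace ℝ (Fin d) × C(I, ℝ) → ℝ) : Prop :=
  ∀ R : ℝ, ∃ K > (0 : ℝ), ∃ p > (0 : ℝ), ∀ z : EuclideanSpace ℝ (Fin d), ‖z‖ ≤ R →
    ∀ x : C(I, ℝ), |g (z, x)| ≤ K * (1 + ‖x‖ ^ p)

/-- `ρ(z, g) = E[g(z, {W_s}_{0 ≤ s ≤ 1})]`. -/
noncomputable def rho {Ω : Type*} {mΩ : MeasurableSpace Ω} (P : Measure Ω) (W : ℝ≥0 → Ω → ℝ)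
    {d : ℕ} (g : EuclideanSpace ℝ (Fin d) × C(I, ℝ) → ℝ) (z : EuclideanSpace ℝ (Fin d)) : ℝ :=
  ∫ ω, g (z, unitPath W ω) ∂P

/-!
Writing `X_i` for the rescaled increment path over the `i`-th mesh interval, the sum splits into the
fluctuation `Δ ∑ (g(a_{t_{i-1}}, X_i) - ρ(a_{t_{i-1}}, g))` and the Riemann sum
`Δ ∑ ρ(a_{t_{i-1}}, g)`. The Riemann sums converge almost surely, because `s ↦ ρ(a_s, g)` is
continuous along almost every path. The terms of the fluctuation are pairwise orthogonal in `L²`: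
`X_i` has the law of `{W_s}_{0 ≤ s ≤ 1}` and is independent of `ℱ_{t_{i-1}}`, so each term is centered
given the past, which contains the earlier terms. Since their second moments are bounded by a
constant `M`, the fluctuation has second moment at most `Δ² (1/Δ) M = Δ M`, which tends to zero.

Three facts carry this argument.

* Laws and measurability of random continuous paths reduce to countably many evaluations: evaluation
  on a dense sequence is a measurable embedding of `C([0,1])` into a space of real sequences
  (`measurableEmbedding_pathEval`), so finite-dimensional distributions determine the law of a path
  (`measure_ext_of_fdd`).
* The supremum norm has all moments (`IsBrownianPath.integrable_norm_rpow`). Instead of showing that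
  the Wiener measure is Gaussian as a measure on `C([0,1])`, one checks on finite-dimensional
  distributions that its square is invariant under rotations (`IsBrownianPath.map_rotation`), which
  is all that the proof of Fernique's theorem uses.
* The increments after time `t` are jointly independent of `ℱ t`
  (`IsFilteredBrownian.indep_incrementSigma`); the hypothesis only provides this for each single
  increment. As the path `X_i` is measurable only up to a null set, which `ℱ` need not contain,
  independence is transferred to the augmentation of the σ-algebras by almost sure equality
  (`nullAugment`, `indep_nullAugment`).
-/

/-! ### Random continuous paths -/

/-- The values of a path on a countable dense set of times. -/
noncomputable def pathEval (x : C(I, ℝ)) (n : ℕ) : ℝ := x (TopologicalSpace.denseSeq I n)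

lemma continuous_pathEval : Continuous pathEval :=
  continuous_pi fun n => continuous_eval_const (TopologicalSpace.denseSeq I n)

lemma pathEval_injective : Function.Injective pathEval := by
  intro x y h
  refine ContinuousMap.ext fun s => congrFun ?_ s
  exact (TopologicalSpace.denseRange_denseSeq I).equalizer x.continuous y.continuous h

/-- By the Lusin–Souslin theorem, the Borel σ-algebra of `C([0,1])` is generated by the evaluations
at a countable dense set of times. -/
lemma measurableEmbedding_pathEval [MeasurableSpace C(I, ℝ)] [BorelSpace C(I, ℝ)] :
    MeasurableEmbedding pathEval :=
  continuous_pathEval.measurableEmbedding pathEval_injective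

lemma measurable_of_measurable_eval {Ω : Type*} {m : MeasurableSpace Ω}
    [MeasurableSpace C(I, ℝ)] [BorelSpace C(I, ℝ)] {X : Ω → C(I, ℝ)}
    (h : ∀ s, Measurable fun ω => X ω s) : Measurable X :=
  measurableEmbedding_pathEval.measurable_comp_iff.1 (measurable_pi_lambda _ fun _ => h _)

lemma measurable_path_eval [MeasurableSpace C(I, ℝ)] [BorelSpace C(I, ℝ)] (s : I) :
    Measurable fun x : C(I, ℝ) => x s :=
  (continuous_eval_const s).measurable

section
variable {Ω : Type*} {mΩ : MeasurableSpace Ω} {P : Measure Ω}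

/-- The set where the paths are continuous need not be measurable, but it contains a measurable set of
full measure, outside of which the path is replaced by zero. -/
lemma aemeasurable_mkD [MeasurableSpace C(I, ℝ)] [BorelSpace C(I, ℝ)] {V : I → Ω → ℝ}
    (hV : ∀ s, Measurable (V s)) (hc : ∀ᵐ ω ∂P, Continuous (V · ω)) :
    AEMeasurable (fun ω => ContinuousMap.mkD (V · ω) 0) P := by
  classical
  obtain ⟨S, hS, hSm, hSc⟩ := hc.exists_measurable_mem
  refine ⟨fun ω => if ω ∈ S then ContinuousMap.mkD (V · ω) 0 else 0, ?_, ?_⟩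
  · refine measurable_of_measurable_eval fun s => ?_
    have : (fun ω => (if ω ∈ S then ContinuousMap.mkD (V · ω) 0 else 0 : C(I, ℝ)) s)
        = fun ω => if ω ∈ S then V s ω else 0 := by
      ext ω
      by_cases h : ω ∈ S
      · simp [h, ContinuousMap.mkD_apply_of_continuous (hSc ω h)]
      · simp [h]
    rw [this]
    exact Measurable.ite hSm (hV s) measurable_const
  · filter_upwards [hS] with ω hω
    simp [hω]

/-- Finite-dimensional distributions determine a law, once the coordinates separate points
measurably. -/
lemma measure_ext_of_fdd {E ι α : Type*} [MeasurableSpace E] [MeasurableSpace α] {φ : E → ι → α}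
    (hφ : MeasurableEmbedding φ) {μ ν : Measure E} [IsFiniteMeasure μ] [IsFiniteMeasure ν]
    (h : ∀ J : Finset ι, μ.map (fun x (j : J) => φ x j) = ν.map (fun x (j : J) => φ x j)) :
    μ = ν := by
  have key : μ.map φ = ν.map φ := by
    refine IsProjectiveLimit.unique
      (P := fun J : Finset ι => μ.map (fun x (j : J) => φ x j)) (fun J => ?_) (fun J => ?_)
    · rw [Measure.map_map (Finset.measurable_restrict J) hφ.measurable]
      rfl
    · rw [Measure.map_map (Finset.measurable_restrict J) hφ.measurable]
      exact (h J).symm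
  rw [← hφ.comap_map μ, key, hφ.comap_map]

/-- A random path is Brownian if its values at each time agree almost surely with those of a
(pre-)Brownian motion restricted to `[0,1]`. -/
structure IsBrownianPath [MeasurableSpace C(I, ℝ)] (X : Ω → C(I, ℝ)) (B : ℝ≥0 → Ω → ℝ)
    (P : Measure Ω) : Prop where
  aemeasurable : AEMeasurable X P
  isPreBrownian : IsPreBrownianReal B P
  ae_eq : ∀ s : I, (fun ω => X ω s) =ᵐ[P] B (toNNReal s)

lemma IsBrownianPath.map_restrict [MeasurableSpace C(I, ℝ)] {X : Ω → C(I, ℝ)} {B : ℝ≥0 → Ω → ℝ}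
    (h : IsBrownianPath X B P) {ι : Type*} (u : ι → I) (J : Finset ι) :
    P.map (fun ω (j : J) => X ω (u j)) =
      (BrownianReal.projectiveFamily (J.image fun j => toNNReal (u j))).map
        (fun x (j : J) => x ⟨toNNReal (u j), Finset.mem_image_of_mem _ j.2⟩) := by
  have hB := h.isPreBrownian.hasLaw (J.image fun j => toNNReal (u j))
  rw [← hB.map_eq, AEMeasurable.map_map_of_aemeasurable
    (measurable_pi_lambda _ fun j => measurable_pi_apply _).aemeasurable hB.aemeasurable]
  refine Measure.map_congr ?_
  have : ∀ᵐ ω ∂P, ∀ j : J, X ω (u j) = B (toNNReal (u j)) ω := ae_all_iff.2 fun j => h.ae_eq (u j)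
  filter_upwards [this] with ω hω
  ext j
  simpa using hω j

/-- All Brownian paths on `[0,1]` have the same law: the Wiener measure. -/
lemma IsBrownianPath.map_eq {Ω' : Type*} {mΩ' : MeasurableSpace Ω'} {P' : Measure Ω'}
    [IsFiniteMeasure P] [IsFiniteMeasure P'] [MeasurableSpace C(I, ℝ)] [BorelSpace C(I, ℝ)]
    {X : Ω → C(I, ℝ)} {B : ℝ≥0 → Ω → ℝ} {X' : Ω' → C(I, ℝ)} {B' : ℝ≥0 → Ω' → ℝ}
    (h : IsBrownianPath X B P) (h' : IsBrownianPath X' B' P') : P.map X = P'.map X' := by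
  refine measure_ext_of_fdd measurableEmbedding_pathEval fun J => ?_
  have hm : Measurable fun (x : C(I, ℝ)) (j : J) => pathEval x j :=
    measurable_pi_lambda _ fun _ => measurable_path_eval _
  rw [AEMeasurable.map_map_of_aemeasurable hm.aemeasurable h.aemeasurable,
    AEMeasurable.map_map_of_aemeasurable hm.aemeasurable h'.aemeasurable]
  exact (h.map_restrict _ J).trans (h'.map_restrict _ J).symm

/-! ### Moments of the supremum norm -/

lemma measurableEmbedding_pathEval_prod [MeasurableSpace C(I, ℝ)] [BorelSpace C(I, ℝ)] :
    MeasurableEmbedding fun (p : C(I, ℝ) × C(I, ℝ)) n => (pathEval p.1 n, pathEval p.2 n) := by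
  refine Continuous.measurableEmbedding (continuous_pi fun n => ?_) fun p q h => ?_
  · exact (((continuous_apply n).comp continuous_pathEval).comp continuous_fst).prodMk
      (((continuous_apply n).comp continuous_pathEval).comp continuous_snd)
  · exact Prod.ext (pathEval_injective (funext fun n => congrArg Prod.fst (congrFun h n)))
      (pathEval_injective (funext fun n => congrArg Prod.snd (congrFun h n)))

/-- The product of the Wiener measure with itself is invariant under rotations: this holds for the
finite-dimensional distributions because these are centered Gaussian. -/
lemma IsBrownianPath.map_rotation [MeasurableSpace C(I, ℝ)] [BorelSpace C(I, ℝ)]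
    {X : Ω → C(I, ℝ)} {B : ℝ≥0 → Ω → ℝ} [IsProbabilityMeasure P] (hX : IsBrownianPath X B P)
    (θ : ℝ) :
    ((P.map X).prod (P.map X)).map (ContinuousLinearMap.rotation θ) =
      (P.map X).prod (P.map X) := by
  have : IsProbabilityMeasure (P.map X) := Measure.isProbabilityMeasure_map hX.aemeasurable
  have hrot : Measurable (ContinuousLinearMap.rotation (E := C(I, ℝ)) θ) :=
    (ContinuousLinearMap.rotation θ).continuous.measurable
  have : IsProbabilityMeasure (((P.map X).prod (P.map X)).map
    (ContinuousLinearMap.rotation θ)) := Measure.isProbabilityMeasure_map hrot.aemeasurable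
  refine measure_ext_of_fdd measurableEmbedding_pathEval_prod fun J => ?_
  -- the law of the vector of values of the path, at the times indexed by `J`
  let r : C(I, ℝ) → J → ℝ := fun x j => pathEval x j
  have hr : Measurable r := measurable_pi_lambda _ fun _ => measurable_path_eval _
  let ν : Measure (J → ℝ) := (P.map X).map r
  have hνB : HasLaw (fun ω (j : J) => B (toNNReal (TopologicalSpace.denseSeq I j)) ω) ν P := by
    refine ⟨aemeasurable_pi_lambda _ fun j => hX.isPreBrownian.aemeasurable _, ?_⟩
    rw [show ν = P.map (r ∘ X) from
      AEMeasurable.map_map_of_aemeasurable hr.aemeasurable hX.aemeasurable]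
    refine Measure.map_congr ?_
    have : ∀ᵐ ω ∂P, ∀ j : J, _ := ae_all_iff.2 fun j : J => hX.ae_eq (TopologicalSpace.denseSeq I j)
    filter_upwards [this] with ω hω
    ext j
    exact (hω j).symm
  have hB := hX.isPreBrownian.isGaussianProcess
  have hgp : IsGaussianProcess (B ∘ fun n : ℕ => toNNReal (TopologicalSpace.denseSeq I n)) P :=
    hB.comp_right _
  have hν : IsGaussian ν := by
    rw [← hνB.map_eq]
    exact (hgp.hasGaussianLaw J).isGaussian_map
  have hν0 : ν[id] = 0 := by
    rw [← hνB.map_eq, integral_map hνB.aemeasurable (by fun_prop)]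
    ext j
    rw [eval_integral]
    · exact hX.isPreBrownian.integral_eval _
    · exact fun i => hX.isPreBrownian.integrable_eval _
  have hνrot := IsGaussian.map_rotation_eq_self hν0 θ
  have hpr : ((P.map X).prod (P.map X)).map (Prod.map r r) = ν.prod ν :=
    (Measure.map_prod_map _ _ hr hr).symm
  let e : (J → ℝ) × (J → ℝ) → J → ℝ × ℝ := fun p j => (p.1 j, p.2 j)
  have he : Measurable e := by fun_prop
  have hrot' : Measurable (ContinuousLinearMap.rotation (E := J → ℝ) θ) :=
    (ContinuousLinearMap.rotation θ).continuous.measurable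
  have e1 : (fun (p : C(I, ℝ) × C(I, ℝ)) (j : J) => (pathEval p.1 j, pathEval p.2 j))
      = e ∘ Prod.map r r := rfl
  have e2 : (e ∘ Prod.map r r) ∘ ContinuousLinearMap.rotation θ
      = e ∘ ContinuousLinearMap.rotation θ ∘ Prod.map r r := by
    funext p j
    simp [e, r, ContinuousLinearMap.rotation_apply, pathEval]
  rw [e1, Measure.map_map (he.comp (hr.prodMap hr)) hrot, e2,
    ← Measure.map_map he (hrot'.comp (hr.prodMap hr)), ← Measure.map_map hrot' (hr.prodMap hr),
    hpr, hνrot, ← hpr, Measure.map_map he (hr.prodMap hr)]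

/-- By Fernique's theorem, the supremum norm has moments of all orders under the Wiener measure. -/
lemma IsBrownianPath.integrable_norm_rpow [MeasurableSpace C(I, ℝ)] [BorelSpace C(I, ℝ)]
    {X : Ω → C(I, ℝ)} {B : ℝ≥0 → Ω → ℝ} [IsProbabilityMeasure P] (h : IsBrownianPath X B P)
    {p : ℝ} (hp : 0 ≤ p) : Integrable (fun x => ‖x‖ ^ p) (P.map X) := by
  have : IsProbabilityMeasure (P.map X) := Measure.isProbabilityMeasure_map h.aemeasurable
  obtain ⟨C, hC, hint⟩ :=
    exists_integrable_exp_sq_of_map_rotation_eq_self (h.map_rotation (-(Real.pi / 4)))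
  obtain ⟨n, hn⟩ := exists_nat_ge p
  have hdom : ∀ x : C(I, ℝ), ‖x‖ ^ p ≤ 1 + (n.factorial / C ^ n) * Real.exp (C * ‖x‖ ^ 2) := by
    intro x
    have h0 : 0 ≤ (n.factorial / C ^ n) * Real.exp (C * ‖x‖ ^ 2) := by positivity
    rcases le_total ‖x‖ 1 with hx | hx
    · have := Real.rpow_le_one (norm_nonneg x) hx hp
      linarith
    · have h1 : ‖x‖ ^ p ≤ (‖x‖ ^ 2) ^ n := by
        rw [← pow_mul, ← Real.rpow_natCast]
        refine Real.rpow_le_rpow_of_exponent_le hx ?_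
        push_cast
        nlinarith [Nat.cast_nonneg (α := ℝ) n]
      have h2 := Real.pow_div_factorial_le_exp (C * ‖x‖ ^ 2) (by positivity) n
      have h3 : (‖x‖ ^ 2) ^ n = (n.factorial / C ^ n) * ((C * ‖x‖ ^ 2) ^ n / n.factorial) := by
        have : (n.factorial : ℝ) ≠ 0 := by positivity
        rw [mul_pow]; field_simp
      have h4 : (n.factorial / C ^ n) * ((C * ‖x‖ ^ 2) ^ n / n.factorial)
          ≤ (n.factorial / C ^ n) * Real.exp (C * ‖x‖ ^ 2) := by gcongr
      linarith
  refine ((integrable_const 1).add (hint.const_mul (n.factorial / C ^ n))).mono'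
    ?_ (ae_of_all _ fun x => ?_)
  · exact (measurable_norm.pow_const p).aestronglyMeasurable
  · rw [Real.norm_of_nonneg (by positivity)]
    exact hdom x

/-! ### Independence of the increments from the past -/

/-- The measurable sets that agree, up to a null set, with a set of the σ-algebra `m`. -/
@[reducible] def nullAugment (m : MeasurableSpace Ω) {mΩ : MeasurableSpace Ω} (P : Measure Ω) :
    MeasurableSpace Ω :=
  eventuallyMeasurableSpace m (ae P) ⊓ mΩ

lemma nullAugment_le (m : MeasurableSpace Ω) : nullAugment m P ≤ mΩ := inf_le_right

lemma le_nullAugment {m : MeasurableSpace Ω} (hm : m ≤ mΩ) : m ≤ nullAugment m P :=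
  le_inf le_eventuallyMeasurableSpace hm

lemma measurable_nullAugment_of_ae_eq {m : MeasurableSpace Ω} {β : Type*} [MeasurableSpace β]
    {f g : Ω → β} (hf : Measurable[mΩ] f) (hg : Measurable[m] g) (hfg : f =ᵐ[P] g) :
    Measurable[nullAugment m P] f := fun _ hs =>
  MeasurableSpace.measurableSet_inf.2
    ⟨hg.eventuallyMeasurable_of_eventuallyEq (l := ae P) hfg hs, hf hs⟩

lemma indep_nullAugment {m₁ m₂ : MeasurableSpace Ω} (h : Indep m₁ m₂ P) :
    Indep (nullAugment m₁ P) (nullAugment m₂ P) P := by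
  rw [Indep_iff] at h ⊢
  rintro s t hs ht
  obtain ⟨s', hs', hss'⟩ := (MeasurableSpace.measurableSet_inf.1 hs).1
  obtain ⟨t', ht', htt'⟩ := (MeasurableSpace.measurableSet_inf.1 ht).1
  rw [measure_congr hss', measure_congr htt', measure_congr (hss'.inter htt'), h s' t' hs' ht']

lemma indep_sup_left [IsZeroOrProbabilityMeasure P] {m₁ m₂ m : MeasurableSpace Ω} (h₁ : m₁ ≤ mΩ)
    (h₂ : m₂ ≤ mΩ) (hm : m ≤ mΩ) (h : Indep m₁ m P) (h' : Indep m₂ (m₁ ⊔ m) P) :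
    Indep (m₁ ⊔ m₂) m P := by
  let p : Set (Set Ω) := {s | ∃ a b, MeasurableSet[m₁] a ∧ MeasurableSet[m₂] b ∧ a ∩ b = s}
  have hp : IsPiSystem p := by
    rintro _ ⟨a, b, ha, hb, rfl⟩ _ ⟨a', b', ha', hb', rfl⟩ -
    exact ⟨a ∩ a', b ∩ b', ha.inter ha', hb.inter hb', by ext; simp; tauto⟩
  have hgen : m₁ ⊔ m₂ = MeasurableSpace.generateFrom p := by
    refine le_antisymm (sup_le (fun s hs => ?_) fun s hs => ?_)
      (MeasurableSpace.generateFrom_le ?_)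
    · exact MeasurableSpace.measurableSet_generateFrom ⟨s, Set.univ, hs, .univ, by simp⟩
    · exact MeasurableSpace.measurableSet_generateFrom ⟨Set.univ, s, .univ, hs, by simp⟩
    · rintro _ ⟨a, b, ha, hb, rfl⟩
      exact MeasurableSet.inter (le_sup_left (a := m₁) (b := m₂) _ ha)
        (le_sup_right (a := m₁) (b := m₂) _ hb)
  refine IndepSets.indep (sup_le h₁ h₂) hm hp (@MeasurableSpace.isPiSystem_measurableSet Ω m) hgen
    (@MeasurableSpace.generateFrom_measurableSet Ω m).symm ?_
  rw [IndepSets_iff]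
  rintro _ t ⟨a, b, ha, hb, rfl⟩ ht
  rw [Indep_iff] at h h'
  have hat : MeasurableSet[m₁ ⊔ m] (a ∩ t) :=
    MeasurableSet.inter (le_sup_left (a := m₁) (b := m) _ ha) (le_sup_right (a := m₁) (b := m) _ ht)
  rw [show a ∩ b ∩ t = b ∩ (a ∩ t) by ext; simp; tauto, h' _ _ hb hat, h _ _ ha ht,
    Set.inter_comm a b, h' _ _ hb (le_sup_left (a := m₁) (b := m) _ ha), mul_assoc]

/-- The σ-algebra generated by the increments of `W` after time `t`. -/
@[reducible] def incrementSigma (W : ℝ≥0 → Ω → ℝ) (t : ℝ≥0) : MeasurableSpace Ω :=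
  ⨆ s : ℝ≥0, MeasurableSpace.comap (fun ω => W (t + s) ω - W t ω) inferInstance

section
variable {ℱ : Filtration ℝ≥0 mΩ} {W : ℝ≥0 → Ω → ℝ}

lemma IsFilteredBrownian.measurable (hW : IsFilteredBrownian W ℱ P) (t : ℝ≥0) : Measurable (W t) :=
  (hW.adapted t).mono (ℱ.le t) le_rfl

lemma IsFilteredBrownian.measurable_increment (hW : IsFilteredBrownian W ℱ P) {s t u : ℝ≥0}
    (hs : s ≤ u) (ht : t ≤ u) : Measurable[ℱ u] fun ω => W s ω - W t ω :=
  ((hW.adapted s).mono (ℱ.mono hs) le_rfl).sub ((hW.adapted t).mono (ℱ.mono ht) le_rfl)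

lemma IsFilteredBrownian.comap_increment_le (hW : IsFilteredBrownian W ℱ P) {s t u : ℝ≥0}
    (hs : s ≤ u) (ht : t ≤ u) :
    MeasurableSpace.comap (fun ω => W s ω - W t ω) inferInstance ≤ ℱ u :=
  (hW.measurable_increment hs ht).comap_le

/-- Finitely many increments after time `t` are jointly independent of `ℱ t`: the increment up to
the latest of the times splits off an increment that is independent of all that came before. -/
lemma IsFilteredBrownian.indep_finset [IsProbabilityMeasure P] (hW : IsFilteredBrownian W ℱ P)
    (t : ℝ≥0) (J : Finset ℝ≥0) :
    Indep (⨆ s ∈ J, MeasurableSpace.comap (fun ω => W (t + s) ω - W t ω) inferInstance) (ℱ t) P := by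
  refine Finset.induction_on_max J ?_ fun m J hm ih => ?_
  · simpa using indep_bot_left _
  · set A : MeasurableSpace Ω :=
      ⨆ s ∈ J, MeasurableSpace.comap (fun ω => W (t + s) ω - W t ω) inferInstance
    let r : ℝ≥0 := J.sup id
    have hrm : r ≤ m := Finset.sup_le fun s hs => (hm s hs).le
    have hAr : A ≤ ℱ (t + r) := iSup₂_le fun s hs => hW.comap_increment_le
      (add_le_add le_rfl (Finset.le_sup (f := id) hs)) le_self_add
    let C : MeasurableSpace Ω :=
      MeasurableSpace.comap (fun ω => W (t + m) ω - W (t + r) ω) inferInstance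
    have hC : C ≤ mΩ :=
      ((hW.measurable (t + m)).sub (hW.measurable (t + r))).comap_le
    have hind : Indep C (A ⊔ ℱ t) P :=
      indep_of_indep_of_le_right (hW.indep_increment (t + r) (t + m) (add_le_add le_rfl hrm))
        (sup_le hAr (ℱ.mono le_self_add))
    refine indep_of_indep_of_le_left
      (indep_sup_left (hAr.trans (ℱ.le _)) hC (ℱ.le t) ih hind) ?_
    rw [Finset.iSup_insert]
    refine sup_le ?_ le_sup_left
    have h1 : Measurable[A ⊔ C] fun ω => W (t + m) ω - W (t + r) ω :=
      Measurable.mono (comap_measurable _) le_sup_right le_rfl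
    have h2 : Measurable[A ⊔ C] fun ω => W (t + r) ω - W t ω := by
      rcases J.eq_empty_or_nonempty with hJ | hJ
      · have : (fun ω => W (t + r) ω - W t ω) = fun _ => 0 := by
          funext ω; simp [r, hJ]
        rw [this]
        exact measurable_const
      · obtain ⟨s, hs, hrs⟩ := Finset.exists_mem_eq_sup J hJ id
        have hrs : r = s := hrs
        have : MeasurableSpace.comap (fun ω => W (t + r) ω - W t ω) inferInstance ≤ A := by
          rw [hrs]
          exact le_iSup₂_of_le (f := fun s (_ : s ∈ J) =>
            MeasurableSpace.comap (fun ω => W (t + s) ω - W t ω) inferInstance) s hs le_rfl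
        exact Measurable.mono (comap_measurable _) (this.trans le_sup_left) le_rfl
    have h3 : (fun ω => W (t + m) ω - W t ω)
        = fun ω => (W (t + m) ω - W (t + r) ω) + (W (t + r) ω - W t ω) := by
      funext ω; ring
    rw [h3]
    exact (h1.add h2).comap_le

lemma IsFilteredBrownian.indep_incrementSigma [IsProbabilityMeasure P]
    (hW : IsFilteredBrownian W ℱ P) (t : ℝ≥0) : Indep (incrementSigma W t) (ℱ t) P := by
  have hle : ∀ s : ℝ≥0,
      MeasurableSpace.comap (fun ω => W (t + s) ω - W t ω) inferInstance ≤ mΩ := fun s =>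
    ((hW.measurable (t + s)).sub (hW.measurable t)).comap_le
  rw [incrementSigma, iSup_eq_iSup_finset]
  refine indep_iSup_of_directed_le (hW.indep_finset t) (fun J => iSup₂_le fun s _ => hle s)
    (ℱ.le t) ?_
  exact Monotone.directed_le fun J J' h => biSup_mono fun s hs => Finset.mem_of_subset h hs

end

/-! ### The Brownian increment paths -/

section
variable {ℱ : Filtration ℝ≥0 mΩ} {W : ℝ≥0 → Ω → ℝ}

lemma isBrownianPath_unitPath [MeasurableSpace C(I, ℝ)] [BorelSpace C(I, ℝ)]
    (hW : IsFilteredBrownian W ℱ P) : IsBrownianPath (unitPath W) W P where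
  aemeasurable := aemeasurable_mkD (V := fun s => W (toNNReal s)) (fun s => hW.measurable _) <| by
    filter_upwards [hW.isBrownian.cont] with ω hω
    exact hω.comp toNNReal_continuous
  isPreBrownian := hW.isBrownian.toIsPreBrownianReal
  ae_eq s := by
    filter_upwards [hW.isBrownian.cont] with ω hω
    exact ContinuousMap.mkD_apply_of_continuous (hω.comp toNNReal_continuous)

lemma ae_continuous_scaledIncrement (hW : IsFilteredBrownian W ℱ P) (t h : ℝ≥0) :
    ∀ᵐ ω ∂P, Continuous fun s : I => (√h)⁻¹ * (W (t + toNNReal s * h) ω - W t ω) := by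
  filter_upwards [hW.isBrownian.cont] with ω hω
  fun_prop

lemma isBrownianPath_scaledIncrementPath [MeasurableSpace C(I, ℝ)] [BorelSpace C(I, ℝ)]
    (hW : IsFilteredBrownian W ℱ P) (t : ℝ≥0) {h : ℝ≥0} (hh : h ≠ 0) :
    IsBrownianPath (scaledIncrementPath W t h)
      (fun s ω => (√h)⁻¹ * (W (t + h * s) ω - W t ω)) P where
  aemeasurable := aemeasurable_mkD
    (V := fun s ω => (√h)⁻¹ * (W (t + toNNReal s * h) ω - W t ω))
    (fun s => ((hW.measurable _).sub (hW.measurable _)).const_mul _)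
    (ae_continuous_scaledIncrement hW t h)
  isPreBrownian := (hW.isBrownian.toIsPreBrownianReal.shift t).smul hh
  ae_eq s := by
    filter_upwards [ae_continuous_scaledIncrement hW t h] with ω hω
    simp only [scaledIncrementPath, ContinuousMap.mkD_apply_of_continuous hω, mul_comm h]

/-- A random path whose values agree almost surely with `m`-measurable variables is measurable for
the augmentation of `m`. -/
lemma measurable_nullAugment_path [MeasurableSpace C(I, ℝ)] [BorelSpace C(I, ℝ)]
    {m : MeasurableSpace Ω} {X : Ω → C(I, ℝ)} (hX : Measurable[mΩ] X) {V : I → Ω → ℝ}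
    (hV : ∀ s, Measurable[m] (V s)) (hXV : ∀ s, (fun ω => X ω s) =ᵐ[P] V s) :
    Measurable[nullAugment m P] X :=
  @measurable_of_measurable_eval Ω (nullAugment m P) _ _ _ fun s =>
    measurable_nullAugment_of_ae_eq ((measurable_path_eval s).comp hX) (hV s) (hXV s)

/-- The rescaled increment path over `[t, t + h]` has a version that is measurable with respect to
the augmented σ-algebra of the increments after `t`, and with respect to the augmented past at any
time from `t + h` on. -/
lemma exists_version_scaledIncrementPath [MeasurableSpace C(I, ℝ)] [BorelSpace C(I, ℝ)]
    [IsProbabilityMeasure P] (hW : IsFilteredBrownian W ℱ P) (t : ℝ≥0) {h : ℝ≥0} (hh : h ≠ 0) :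
    ∃ X : Ω → C(I, ℝ), scaledIncrementPath W t h =ᵐ[P] X ∧
      Measurable[nullAugment (incrementSigma W t) P] X ∧
      (∀ u, t + h ≤ u → Measurable[nullAugment (ℱ u) P] X) ∧
      P.map X = P.map (unitPath W) := by
  have hB := isBrownianPath_scaledIncrementPath hW t hh
  have hXV : ∀ s : I, (fun ω => hB.aemeasurable.mk _ ω s) =ᵐ[P]
      fun ω => (√h)⁻¹ * (W (t + h * toNNReal s) ω - W t ω) := fun s => by
    filter_upwards [hB.aemeasurable.ae_eq_mk, hB.ae_eq s] with ω h1 h2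
    rw [← h1, h2]
  refine ⟨hB.aemeasurable.mk _, hB.aemeasurable.ae_eq_mk, ?_, fun u hu => ?_, ?_⟩
  · refine measurable_nullAugment_path hB.aemeasurable.measurable_mk (fun s => ?_) hXV
    refine Measurable.const_mul ?_ _
    exact (comap_measurable _).mono (le_iSup (fun s : ℝ≥0 =>
      MeasurableSpace.comap (fun ω => W (t + s) ω - W t ω) inferInstance) (h * toNNReal s)) le_rfl
  · refine measurable_nullAugment_path hB.aemeasurable.measurable_mk (fun s => ?_) hXV
    refine Measurable.const_mul (hW.measurable_increment (le_trans ?_ hu)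
      (le_self_add.trans hu)) _
    gcongr
    exact mul_le_of_le_one_right' (by exact_mod_cast s.2.2)
  · rw [← Measure.map_congr hB.aemeasurable.ae_eq_mk]
    exact hB.map_eq (isBrownianPath_unitPath hW)

end

/-! ### Sums of conditionally centered variables -/

section
variable {T E : Type*} [MeasurableSpace T] [MeasurableSpace E]

/-- If `X` is independent of `(η, Z)` and `f (z, X)` is centered for every fixed `z`, then
`f (Z, X)` is orthogonal to `η`. -/
lemma integral_mul_eq_zero_of_indep {Ω : Type*} {m m' mΩ : MeasurableSpace Ω} {P : Measure Ω}
    [IsProbabilityMeasure P] (hm : m ≤ mΩ) (hm' : m' ≤ mΩ) (hind : Indep m m' P) {η : Ω → ℝ} (hη : Measurable[m] η)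
    {Z : Ω → T} (hZ : Measurable[m] Z) {X : Ω → E} (hX : Measurable[m'] X) {f : T × E → ℝ}
    (hf : Measurable f) (hf0 : ∀ z, ∫ x, f (z, x) ∂(P.map X) = 0)
    (hint : Integrable (fun ω => η ω * f (Z ω, X ω)) P) :
    ∫ ω, η ω * f (Z ω, X ω) ∂P = 0 := by
  have hU : Measurable[m] fun ω => (η ω, Z ω) := hη.prodMk hZ
  have hU' : Measurable[mΩ] fun ω => (η ω, Z ω) := hU.mono hm le_rfl
  have hX' : Measurable[mΩ] X := hX.mono hm' le_rfl
  have hindf : IndepFun (fun ω => (η ω, Z ω)) X P := by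
    rw [IndepFun_iff_Indep]
    exact indep_of_indep_of_le hind hU.comap_le hX.comap_le
  have hlaw := (indepFun_iff_map_prod_eq_prod_map_map hU'.aemeasurable hX'.aemeasurable).1 hindf
  let F : (ℝ × T) × E → ℝ := fun q => q.1.1 * f (q.1.2, q.2)
  have hF : Measurable F := by fun_prop
  have hpair : Measurable[mΩ] fun ω => ((η ω, Z ω), X ω) := hU'.prodMk hX'
  have hFint : Integrable F ((P.map fun ω => (η ω, Z ω)).prod (P.map X)) := by
    rw [← hlaw, integrable_map_measure hF.aestronglyMeasurable hpair.aemeasurable]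
    exact hint
  have e : ∫ ω, η ω * f (Z ω, X ω) ∂P = ∫ q, F q ∂(P.map fun ω => ((η ω, Z ω), X ω)) :=
    (integral_map hpair.aemeasurable hF.aestronglyMeasurable).symm
  rw [e, hlaw, integral_prod _ hFint]
  simp [F, integral_const_mul, hf0]

/-- Second moment bound for a sum of variables `f (Z i, X i)`, where `Z i` and the earlier `X j` belong
to a past `m i` that is independent of `X i`: the mixed terms vanish. -/
lemma integral_sq_sum_le_of_indep [IsProbabilityMeasure P] {m m' : ℕ → MeasurableSpace Ω}
    (hm : ∀ i, m i ≤ mΩ) (hm' : ∀ i, m' i ≤ mΩ) (hind : ∀ i, Indep (m i) (m' i) P)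
    (hmono : Monotone m) {Z : ℕ → Ω → T} (hZ : ∀ i, Measurable[m i] (Z i)) {X : ℕ → Ω → E}
    (hX : ∀ i, Measurable[m' i] (X i)) (hX' : ∀ i j, i < j → Measurable[m j] (X i))
    {μ : Measure E} (hμ : ∀ i, P.map (X i) = μ) {f : T × E → ℝ} (hf : Measurable f)
    (hf0 : ∀ z, ∫ x, f (z, x) ∂μ = 0) {Q : E → ℝ} (hQ : Integrable Q μ)
    (hfQ : ∀ z x, f (z, x) ^ 2 ≤ Q x) (N : ℕ) :
    Integrable (fun ω => (∑ i ∈ Finset.range N, f (Z i ω, X i ω)) ^ 2) P ∧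
    ∫ ω, (∑ i ∈ Finset.range N, f (Z i ω, X i ω)) ^ 2 ∂P ≤ N * ∫ x, Q x ∂μ := by
  have hXm : ∀ i, Measurable[mΩ] (X i) := fun i => (hX i).mono (hm' i) le_rfl
  have hfm : ∀ i, Measurable[mΩ] fun ω => f (Z i ω, X i ω) := fun i =>
    hf.comp (((hZ i).mono (hm i) le_rfl).prodMk (hXm i))
  have hQi : ∀ i, Integrable (fun ω => Q (X i ω)) P := fun i =>
    (integrable_map_measure (by rw [hμ]; exact hQ.1) (hXm i).aemeasurable).1 (by rwa [hμ])
  have hQe : ∀ i, ∫ ω, Q (X i ω) ∂P = ∫ x, Q x ∂μ := fun i => by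
    rw [← hμ i, integral_map (hXm i).aemeasurable (by rw [hμ]; exact hQ.1)]
  have hL2 : ∀ i, MemLp (fun ω => f (Z i ω, X i ω)) 2 P := fun i => by
    rw [memLp_two_iff_integrable_sq (hfm i).aestronglyMeasurable]
    refine (hQi i).mono' ((hfm i).pow_const 2).aestronglyMeasurable (ae_of_all _ fun ω => ?_)
    rw [Real.norm_of_nonneg (sq_nonneg _)]
    exact hfQ _ _
  have hprod : ∀ i j, Integrable (fun ω => f (Z i ω, X i ω) * f (Z j ω, X j ω)) P := fun i j =>
    (hL2 i).integrable_mul (hL2 j)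
  have hlt : ∀ i j, i < j → ∫ ω, f (Z i ω, X i ω) * f (Z j ω, X j ω) ∂P = 0 := fun i j hij => by
    refine integral_mul_eq_zero_of_indep (hm j) (hm' j) (hind j) ?_ (hZ j) (hX j) hf
      (by simpa [hμ] using hf0) (hprod i j)
    exact hf.comp (((hZ i).mono (hmono hij.le) le_rfl).prodMk (hX' i j hij))
  have hne : ∀ i j, i ≠ j → ∫ ω, f (Z i ω, X i ω) * f (Z j ω, X j ω) ∂P = 0 := fun i j hij => by
    rcases lt_or_gt_of_ne hij with h | h
    · exact hlt i j h
    · simpa only [mul_comm] using hlt j i h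
  have hexp : (fun ω => (∑ i ∈ Finset.range N, f (Z i ω, X i ω)) ^ 2) = fun ω =>
      ∑ i ∈ Finset.range N, ∑ j ∈ Finset.range N, f (Z i ω, X i ω) * f (Z j ω, X j ω) := by
    funext ω
    rw [sq, Finset.sum_mul_sum]
  rw [hexp]
  refine ⟨integrable_finsetSum _ fun i _ => integrable_finsetSum _ fun j _ => hprod i j, ?_⟩
  rw [integral_finsetSum _ fun i _ => integrable_finsetSum _ fun j _ => hprod i j]
  calc ∑ i ∈ Finset.range N, ∫ ω, ∑ j ∈ Finset.range N, f (Z i ω, X i ω) * f (Z j ω, X j ω) ∂P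
      ≤ ∑ i ∈ Finset.range N, ∫ x, Q x ∂μ := Finset.sum_le_sum fun i hi => ?_
    _ = N * ∫ x, Q x ∂μ := by simp
  rw [integral_finsetSum _ fun j _ => hprod i j,
    Finset.sum_eq_single_of_mem i hi fun j _ hj => hne i j hj.symm, ← hQe i]
  refine integral_mono (hprod i i) (hQi i) fun ω => ?_
  simpa only [sq] using hfQ (Z i ω) (X i ω)

end

/-! ### Convergence in measure -/

lemma tendstoInMeasure_zero_of_integral_sq [IsFiniteMeasure P] {S : ℕ → Ω → ℝ}
    (hS : ∀ n, Integrable (fun ω => S n ω ^ 2) P)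
    (h : Tendsto (fun n => ∫ ω, S n ω ^ 2 ∂P) atTop (𝓝 0)) :
    TendstoInMeasure P S atTop fun _ => 0 := by
  rw [tendstoInMeasure_iff_measureReal_norm]
  intro ε hε
  have h' : Tendsto (fun n => (∫ ω, S n ω ^ 2 ∂P) / ε ^ 2) atTop (𝓝 0) := by
    simpa using h.div_const (ε ^ 2)
  refine squeeze_zero (fun n => measureReal_nonneg) (fun n => ?_) h'
  rw [le_div_iff₀ (by positivity), mul_comm]
  have hset : {ω | ε ≤ ‖S n ω - 0‖} = {ω | ε ^ 2 ≤ S n ω ^ 2} := by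
    ext ω
    simp only [sub_zero, Real.norm_eq_abs, Set.mem_ofPred_eq]
    rw [sq_le_sq, abs_of_pos hε]
  rw [hset]
  exact mul_meas_ge_le_integral_of_nonneg (ae_of_all _ fun ω => sq_nonneg _) (hS n) _

lemma tendstoInMeasure_add_of_tendsto_zero [IsFiniteMeasure P] {S R : ℕ → Ω → ℝ} {r : Ω → ℝ}
    (hS : TendstoInMeasure P S atTop fun _ => 0) (hR : TendstoInMeasure P R atTop r) :
    TendstoInMeasure P (fun n ω => S n ω + R n ω) atTop r := by
  rw [tendstoInMeasure_iff_measureReal_norm] at *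
  intro ε hε
  have h := (hS (ε / 2) (half_pos hε)).add (hR (ε / 2) (half_pos hε))
  rw [add_zero] at h
  refine squeeze_zero (fun n => measureReal_nonneg) (fun n => ?_) h
  refine (measureReal_mono fun ω hω => ?_).trans (measureReal_union_le _ _)
  simp only [Set.mem_ofPred_eq, Set.mem_union, sub_zero] at hω ⊢
  by_contra! hcon
  have := norm_add_le (S n ω) (R n ω - r ω)
  rw [show S n ω + R n ω - r ω = S n ω + (R n ω - r ω) by ring] at hω
  linarith

/-! ### Riemann sums -/

lemma tendsto_riemannSum {F : ℝ → ℝ} (hF : Continuous F) {δ : ℕ → ℝ} (hδ : ∀ n, 0 < δ n)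
    (hδ0 : Tendsto δ atTop (𝓝 0)) {N : ℕ → ℕ} (hN : ∀ n, N n * δ n = 1) :
    Tendsto (fun n => δ n * ∑ i ∈ Finset.range (N n), F (i * δ n)) atTop
      (𝓝 (∫ s in (0 : ℝ)..1, F s)) := by
  have huc := isCompact_Icc.uniformContinuousOn_of_continuous
    (hF.continuousOn (s := Set.Icc (0 : ℝ) 1))
  rw [Metric.uniformContinuousOn_iff_le] at huc
  rw [Metric.tendsto_atTop']
  intro ε hε
  obtain ⟨η, hη, hη'⟩ := huc (ε / 2) (half_pos hε)
  obtain ⟨n₀, hn₀⟩ := (eventually_atTop.1 (hδ0.eventually (gt_mem_nhds hη)))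
  refine ⟨n₀, fun n hn => ?_⟩
  have hsum : ∑ i ∈ Finset.range (N n), ∫ s in (i * δ n)..((i + 1 : ℕ) * δ n), F s
      = ∫ s in (0 : ℝ)..1, F s := by
    rw [intervalIntegral.sum_integral_adjacent_intervals (a := fun i : ℕ => i * δ n)
      fun k _ => hF.intervalIntegrable _ _]
    simp [hN n]
  have hdiff : δ n * ∑ i ∈ Finset.range (N n), F (i * δ n) - ∫ s in (0 : ℝ)..1, F s
      = ∑ i ∈ Finset.range (N n), ∫ s in (i * δ n)..((i + 1 : ℕ) * δ n), (F (i * δ n) - F s) := by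
    rw [← hsum, Finset.mul_sum, ← Finset.sum_sub_distrib]
    refine Finset.sum_congr rfl fun i _ => ?_
    rw [intervalIntegral.integral_sub intervalIntegrable_const (hF.intervalIntegrable _ _),
      intervalIntegral.integral_const, smul_eq_mul]
    push_cast
    ring
  rw [Real.dist_eq, hdiff]
  have hterm : ∀ i ∈ Finset.range (N n),
      |∫ s in (i * δ n)..((i + 1 : ℕ) * δ n), (F (i * δ n) - F s)| ≤ ε / 2 * δ n := by
    intro i hi
    have hlen : ((i + 1 : ℕ) : ℝ) * δ n - i * δ n = δ n := by push_cast; ring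
    have hle : (i : ℝ) * δ n ≤ (i + 1 : ℕ) * δ n := by linarith [hδ n]
    have hi1 : ((i + 1 : ℕ) : ℝ) * δ n ≤ 1 := by
      rw [← hN n]
      exact mul_le_mul_of_nonneg_right (by exact_mod_cast Finset.mem_range.1 hi) (hδ n).le
    have hi0 : 0 ≤ (i : ℝ) * δ n := mul_nonneg i.cast_nonneg (hδ n).le
    rw [← Real.norm_eq_abs]
    refine (intervalIntegral.norm_integral_le_of_norm_le_const (C := ε / 2) fun s hs => ?_).trans ?_
    · rw [Set.uIoc_of_le hle] at hs
      rw [← dist_eq_norm]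
      refine hη' _ ⟨hi0, hle.trans hi1⟩ _ ⟨hi0.trans hs.1.le, hs.2.trans hi1⟩ ?_
      rw [Real.dist_eq, abs_sub_comm, abs_of_pos (sub_pos.2 hs.1)]
      linarith [hs.2, hn₀ n hn.le]
    · rw [hlen, abs_of_pos (hδ n)]
  calc |∑ i ∈ Finset.range (N n), ∫ s in (i * δ n)..((i + 1 : ℕ) * δ n), (F (i * δ n) - F s)|
      ≤ ∑ i ∈ Finset.range (N n), ε / 2 * δ n :=
        (Finset.abs_sum_le_sum_abs _ _).trans (Finset.sum_le_sum hterm)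
    _ = ε / 2 := by
        rw [Finset.sum_const, Finset.card_range, nsmul_eq_mul, mul_left_comm, hN n, mul_one]
    _ < ε := half_lt_self hε

/-! ### The law of large numbers -/

lemma integrable_of_polynomialGrowth [IsProbabilityMeasure P] {d : ℕ} [MeasurableSpace C(I, ℝ)]
    [BorelSpace C(I, ℝ)] {X : Ω → C(I, ℝ)} {B : ℝ≥0 → Ω → ℝ} (hX : IsBrownianPath X B P)
    {g : EuclideanSpace ℝ (Fin d) × C(I, ℝ) → ℝ} (hg : Measurable g)
    (hgrowth : PolynomialGrowthInPath g) (z : EuclideanSpace ℝ (Fin d)) :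
    Integrable (fun x => g (z, x)) (P.map X) := by
  have : IsProbabilityMeasure (P.map X) := Measure.isProbabilityMeasure_map hX.aemeasurable
  obtain ⟨K, -, p, hp, h⟩ := hgrowth ‖z‖
  refine (((integrable_const 1).add (hX.integrable_norm_rpow hp.le)).const_mul K).mono'
    (hg.comp measurable_prodMk_left).aestronglyMeasurable (ae_of_all _ fun x => ?_)
  exact h z le_rfl x

/-- The truncation of `g` to the parameters of norm at most `R`, centered in the path variable
under the law `μ`. The truncation makes the growth bound of `g` uniform in the parameter. -/
noncomputable def truncatedCentered {d : ℕ} [MeasurableSpace C(I, ℝ)]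
    (g : EuclideanSpace ℝ (Fin d) × C(I, ℝ) → ℝ) (μ : Measure C(I, ℝ)) (R : ℝ)
    (q : EuclideanSpace ℝ (Fin d) × C(I, ℝ)) : ℝ :=
  ({q | ‖q.1‖ ≤ R}.indicator g q) - ∫ y, {q | ‖q.1‖ ≤ R}.indicator g (q.1, y) ∂μ

section
variable {d : ℕ} [MeasurableSpace C(I, ℝ)] {g : EuclideanSpace ℝ (Fin d) × C(I, ℝ) → ℝ}
  {μ : Measure C(I, ℝ)} {R : ℝ}

lemma measurable_truncatedCentered [SFinite μ] (hg : Measurable g) :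
    Measurable (truncatedCentered g μ R) := by
  have hi : Measurable ({q : EuclideanSpace ℝ (Fin d) × C(I, ℝ) | ‖q.1‖ ≤ R}.indicator g) :=
    hg.indicator (measurableSet_le (measurable_norm.comp measurable_fst) measurable_const)
  exact hi.sub
    ((hi.stronglyMeasurable.integral_prod_right' (ν := μ)).measurable.comp measurable_fst)

lemma truncatedCentered_of_le {z : EuclideanSpace ℝ (Fin d)} (hz : ‖z‖ ≤ R) (x : C(I, ℝ)) :
    truncatedCentered g μ R (z, x) = g (z, x) - ∫ y, g (z, y) ∂μ := by
  simp [truncatedCentered, Set.indicator, hz]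

lemma truncatedCentered_of_not_le {z : EuclideanSpace ℝ (Fin d)} (hz : ¬ ‖z‖ ≤ R) (x : C(I, ℝ)) :
    truncatedCentered g μ R (z, x) = 0 := by
  simp [truncatedCentered, Set.indicator, hz]

lemma integral_truncatedCentered [IsProbabilityMeasure μ]
    (hg : ∀ z, Integrable (fun x => g (z, x)) μ) (z : EuclideanSpace ℝ (Fin d)) :
    ∫ x, truncatedCentered g μ R (z, x) ∂μ = 0 := by
  by_cases hz : ‖z‖ ≤ R
  · simp_rw [truncatedCentered_of_le hz]
    rw [integral_sub (hg z) (integrable_const _)]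
    simp
  · simp [truncatedCentered_of_not_le hz]

/-- The truncated centered function is square integrable in the path, uniformly in the
parameter. -/
lemma exists_sq_truncatedCentered_le [IsProbabilityMeasure μ] [BorelSpace C(I, ℝ)]
    (hμ : ∀ p : ℝ, 0 ≤ p → Integrable (fun x => ‖x‖ ^ p) μ) (hgrowth : PolynomialGrowthInPath g)
    (R : ℝ) :
    ∃ Q : C(I, ℝ) → ℝ, Integrable Q μ ∧ ∀ z x, truncatedCentered g μ R (z, x) ^ 2 ≤ Q x := by
  obtain ⟨K, hK, p, hp, h⟩ := hgrowth R
  have hG : Integrable (fun x : C(I, ℝ) => K * (1 + ‖x‖ ^ p)) μ :=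
    ((integrable_const 1).add (hμ p hp.le)).const_mul K
  obtain ⟨c, hc, hcz⟩ : ∃ c : ℝ, 0 ≤ c ∧ ∀ z, ‖z‖ ≤ R → |∫ y, g (z, y) ∂μ| ≤ c :=
    ⟨∫ x, K * (1 + ‖x‖ ^ p) ∂μ, integral_nonneg fun x => by positivity, fun z hz =>
      norm_integral_le_of_norm_le (f := fun y => g (z, y)) hG (ae_of_all _ fun y => h z hz y)⟩
  refine ⟨fun x => (K + c) ^ 2 + 2 * (K + c) * K * ‖x‖ ^ p + K ^ 2 * ‖x‖ ^ (2 * p),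
    ((integrable_const _).add ((hμ p hp.le).const_mul _)).add
      ((hμ (2 * p) (by positivity)).const_mul _), fun z x => ?_⟩
  have hx : 0 ≤ ‖x‖ ^ p := Real.rpow_nonneg (norm_nonneg x) p
  have hbound : |truncatedCentered g μ R (z, x)| ≤ K * (1 + ‖x‖ ^ p) + c := by
    by_cases hz : ‖z‖ ≤ R
    · rw [truncatedCentered_of_le hz]
      exact (abs_sub _ _).trans (add_le_add (h z hz x) (hcz z hz))
    · rw [truncatedCentered_of_not_le hz, abs_zero]
      positivity
  have e : ‖x‖ ^ (2 * p) = (‖x‖ ^ p) ^ 2 := by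
    rw [mul_comm, Real.rpow_mul (norm_nonneg x), Real.rpow_two]
  simp only [e]
  rw [← sq_abs]
  calc |truncatedCentered g μ R (z, x)| ^ 2 ≤ (K * (1 + ‖x‖ ^ p) + c) ^ 2 := by gcongr
    _ = _ := by ring

end

end

theorem theoremA1 {Ω : Type*} {mΩ : MeasurableSpace Ω} (P : Measure Ω) [IsProbabilityMeasure P]
    (ℱ : Filtration ℝ≥0 mΩ) (W : ℝ≥0 → Ω → ℝ) (hW : IsFilteredBrownian W ℱ P)
    -- the mesh sizes, with `1 / Δ n` the integer `N n`
    (Δ : ℕ → ℝ≥0) (hΔ_pos : ∀ n, 0 < Δ n) (hΔ_lim : Tendsto Δ atTop (𝓝 0))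
    (N : ℕ → ℕ) (hN : ∀ n, (N n : ℝ≥0) = 1 / Δ n)
    -- the bounded, continuous, adapted process
    {d : ℕ} (a : ℝ≥0 → Ω → EuclideanSpace ℝ (Fin d))
    (ha_adapted : Adapted ℱ a)
    (ha_cont : ∀ᵐ ω ∂P, Continuous (fun t => a t ω))
    (ha_bdd : ∃ C : ℝ, ∀ᵐ ω ∂P, ∀ t, ‖a t ω‖ ≤ C)
    -- the test function, measurable for the Borel sets of the space of paths
    [MeasurableSpace C(I, ℝ)] [BorelSpace C(I, ℝ)]
    (g : EuclideanSpace ℝ (Fin d) × C(I, ℝ) → ℝ)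
    (hg_meas : Measurable g) (hg_growth : PolynomialGrowthInPath g)
    (hg_cont : Continuous (rho P W g)) :
    (∀ z, Integrable (fun ω => g (z, unitPath W ω)) P) ∧
    (∀ᵐ ω ∂P, IntervalIntegrable (fun s : ℝ => rho P W g (a s.toNNReal ω)) volume 0 1) ∧
    TendstoInMeasure P
      (fun n ω => (Δ n : ℝ) *
        ∑ i ∈ Finset.Icc 1 (N n),
          g (a (((i - 1 : ℕ) : ℝ≥0) * Δ n) ω,
            scaledIncrementPath W (((i - 1 : ℕ) : ℝ≥0) * Δ n) (Δ n) ω))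
      atTop
      (fun ω => ∫ s in (0 : ℝ)..1, rho P W g (a s.toNNReal ω)) := by
  have hU := isBrownianPath_unitPath hW
  set μ : Measure C(I, ℝ) := P.map (unitPath W)
  have : IsProbabilityMeasure μ := Measure.isProbabilityMeasure_map hU.aemeasurable
  have hgz : ∀ z, Measurable fun x : C(I, ℝ) => g (z, x) := fun z =>
    hg_meas.comp measurable_prodMk_left
  have hgi : ∀ z, Integrable (fun x => g (z, x)) μ :=
    integrable_of_polynomialGrowth hU hg_meas hg_growth
  have hrho : ∀ z, rho P W g z = ∫ x, g (z, x) ∂μ := fun z =>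
    (integral_map hU.aemeasurable (hgz z).aestronglyMeasurable).symm
  have hFcont : ∀ᵐ ω ∂P, Continuous fun s : ℝ => rho P W g (a s.toNNReal ω) := by
    filter_upwards [ha_cont] with ω hω
    exact hg_cont.comp (hω.comp continuous_real_toNNReal)
  refine ⟨fun z => (hgi z).comp_aemeasurable hU.aemeasurable, ?_, ?_⟩
  · filter_upwards [hFcont] with ω hω
    exact hω.intervalIntegrable 0 1
  obtain ⟨R, hR⟩ := ha_bdd
  have hNΔ : ∀ n, (N n : ℝ) * (Δ n : ℝ) = 1 := fun n => by
    have h : (N n : ℝ≥0) * Δ n = 1 := by rw [hN n, one_div_mul_cancel (hΔ_pos n).ne']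
    exact_mod_cast h
  have hΔ0 : Tendsto (fun n => (Δ n : ℝ)) atTop (𝓝 0) := NNReal.tendsto_coe.2 hΔ_lim
  -- versions of the rescaled increment paths, with exact measurability for the augmented σ-algebras
  choose X hX hXind hXpast hXlaw using fun n i : ℕ =>
    exists_version_scaledIncrementPath hW ((i : ℝ≥0) * Δ n) (hΔ_pos n).ne'
  obtain ⟨Q, hQ, hfQ⟩ := exists_sq_truncatedCentered_le (μ := μ)
    (fun p hp => hU.integrable_norm_rpow hp) hg_growth R
  -- the fluctuations around the conditional means
  let S : ℕ → Ω → ℝ := fun n ω => (Δ n : ℝ) *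
    ∑ i ∈ Finset.range (N n), truncatedCentered g μ R (a (i * Δ n) ω, X n i ω)
  have hvar := fun n => integral_sq_sum_le_of_indep (P := P)
    (m := fun i : ℕ => nullAugment (ℱ (i * Δ n)) P)
    (m' := fun i : ℕ => nullAugment (incrementSigma W (i * Δ n)) P)
    (fun i => nullAugment_le _) (fun i => nullAugment_le _)
    (fun i => (indep_nullAugment (hW.indep_incrementSigma _)).symm)
    (fun i j hij => inf_le_inf_right _ fun s ⟨t, ht, hst⟩ => ⟨t, ℱ.mono (by gcongr) _ ht, hst⟩)
    (Z := fun i => a (i * Δ n))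
    (fun i => (ha_adapted _).mono (le_nullAugment (ℱ.le _)) le_rfl)
    (X := X n) (hXind n)
    (fun i j hij => hXpast n i _ (by
      rw [← add_one_mul]
      gcongr
      exact_mod_cast hij))
    (hXlaw n) (measurable_truncatedCentered (R := R) hg_meas) (integral_truncatedCentered hgi)
    hQ hfQ (N n)
  have hSlim : TendstoInMeasure P S atTop fun _ => 0 := by
    refine tendstoInMeasure_zero_of_integral_sq (fun n => ?_) ?_
    · simp only [S, mul_pow]
      exact (hvar n).1.const_mul _
    · refine squeeze_zero (fun n => integral_nonneg fun ω => sq_nonneg _) (fun n => ?_)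
        (by simpa using hΔ0.mul_const (∫ x, Q x ∂μ))
      simp only [S, mul_pow]
      rw [integral_const_mul]
      calc (Δ n : ℝ) ^ 2 * _ ≤ (Δ n : ℝ) ^ 2 * (N n * ∫ x, Q x ∂μ) := by gcongr; exact (hvar n).2
        _ = (N n * Δ n) * (Δ n * ∫ x, Q x ∂μ) := by ring
        _ = Δ n * ∫ x, Q x ∂μ := by rw [hNΔ n, one_mul]
  have hRlim : TendstoInMeasure P
      (fun n ω => (Δ n : ℝ) * ∑ i ∈ Finset.range (N n), rho P W g (a (i * Δ n) ω)) atTop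
      (fun ω => ∫ s in (0 : ℝ)..1, rho P W g (a s.toNNReal ω)) := by
    refine tendstoInMeasure_of_tendsto_ae (fun n => ?_) ?_
    · refine (Measurable.const_mul (Finset.measurable_fun_sum _ fun i _ => ?_)
        _).aestronglyMeasurable
      exact hg_cont.measurable.comp ((ha_adapted _).mono (ℱ.le _) le_rfl)
    · filter_upwards [hFcont] with ω hω
      refine (tendsto_riemannSum hω (fun n => NNReal.coe_pos.2 (hΔ_pos n)) hΔ0 hNΔ).congr
        fun n => ?_
      have : ∀ i : ℕ, ((i : ℝ) * (Δ n : ℝ)).toNNReal = i * Δ n := fun i => by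
        rw [show (i : ℝ) * (Δ n : ℝ) = ((i * Δ n : ℝ≥0) : ℝ) by push_cast; rfl, Real.toNNReal_coe]
      simp_rw [this]
  refine (tendstoInMeasure_add_of_tendsto_zero hSlim hRlim).congr_left fun n => ?_
  have hXn : ∀ᵐ ω ∂P, ∀ i : ℕ, scaledIncrementPath W (i * Δ n) (Δ n) ω = X n i ω :=
    ae_all_iff.2 fun i => hX n i
  filter_upwards [hR, hXn] with ω hω hXω
  simp only [S]
  rw [← mul_add, ← Finset.sum_add_distrib, ← Finset.Ico_add_one_right_eq_Icc,
    Finset.sum_Ico_eq_sum_range]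
  refine congrArg _ (Finset.sum_congr rfl fun i _ => ?_)
  rw [truncatedCentered_of_le (hω _), hrho, sub_add_cancel, Nat.add_sub_cancel_left, hXω]
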